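/- Let $\mathbb{N}$ be the set of positive integers. For $A\subseteq\mathbb{N}$ and an integer $h\ge 0$ let $hA$ be the set of all sums of exactly $h$ not necessarily distinct elements of $A$. For an integer $h\geq 1$, the set $A$ is called an integer basis of order $h$ if all but finitely many elements of $\mathbb{N}$ lie in $hA$, but infinitely many elements of $\mathbb{N}$ do not lie in $(h-1)A$. A finite subset $E$ of an integer basis $A$ is called essential if $A\setminus E$ is not an integer basis of any order and $E$ is minimal, with respect to inclusion, with this property. For positive integers $h,k$ let $E(h,k)$ be the maximum, over all integer bases $A$ of order $h$, of the number of essential subsets of $A$ of size $k$. Theorem 1.1. For all positive integers $h,k$ the maximum $E(h,k)$ exists and is finite, and for each fixed integer $h\geq 1$, as $k\to\infty$, $$E(h,k)\sim (h-1)\,\frac{\log k}{\log\log k},$$ where $f(k)\sim g(k)$ means $f(k)-g(k)=o(g(k))$. In particular, for $h=1$ this says that $E(1,k)=0$ for all sufficiently large $k$. -/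

import Mathlib

namespace EssentialSubsets

/-- The `h`-fold sumset `hA`: all sums of exactly `h` not necessarily distinct elements of `A`. -/
def sumset (h : ℕ) (A : Set ℕ) : Set ℕ :=
  {n | ∃ f : Fin h → ℕ, (∀ i, f i ∈ A) ∧ ∑ i, f i = n}

/-- All but finitely many positive integers lie in `B`. -/
def AlmostAll (B : Set ℕ) : Prop :=
  {n : ℕ | 0 < n ∧ n ∉ B}.Finite

/-- `A` is a set of positive integers that is an (asymptotic) basis of order (exactly) `h`
for the positive integers. -/
structure IsBasisOfOrder (A : Set ℕ) (h : ℕ) : Prop where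
  pos_of_mem : ∀ a ∈ A, 0 < a
  order_pos : 0 < h
  almostAll : AlmostAll (sumset h A)
  not_almostAll : ¬ AlmostAll (sumset (h - 1) A)

/-- `A` is an integer basis, that is, a basis of some order for the positive integers. -/
def IsIntegerBasis (A : Set ℕ) : Prop :=
  ∃ h : ℕ, IsBasisOfOrder A h

/-- `E` is an essential subset of the integer basis `A`: a finite subset of `A` which is minimal
(for inclusion) with the property that `A \ E` is no longer a basis of any order. -/
def IsEssentialSubset (A : Set ℕ) (E : Finset ℕ) : Prop :=
  Minimal (fun F : Finset ℕ => (F : Set ℕ) ⊆ A ∧ ¬ IsIntegerBasis (A \ (F : Set ℕ))) E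

/-- The number (possibly infinite) of essential subsets of size `k` of `A`. -/
noncomputable def numEssential (A : Set ℕ) (k : ℕ) : ℕ∞ :=
  {E : Finset ℕ | IsEssentialSubset A E ∧ E.card = k}.encard

/-- All the values taken by the number of essential subsets of size `k`, over all integer bases
of order `h`. -/
def essentialCounts (h k : ℕ) : Set ℕ∞ :=
  {s | ∃ A : Set ℕ, IsBasisOfOrder A h ∧ numEssential A k = s}

/-- `E(h,k)`, the maximum possible number of essential subsets of size `k` in an integer basis of
order `h`. (It is `0` by convention if the supremum is infinite; the theorem asserts that the
supremum is finite and attained.) -/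
noncomputable def maxEssential (h k : ℕ) : ℕ :=
  (sSup (essentialCounts h k)).toNat

end EssentialSubsets

namespace EssentialSubsets

/-! Removing a finite set from a basis destroys it exactly when what remains lies in one residue
class modulo some prime (`IsIntegerBasis.not_diff_iff`). By minimality an essential subset consists
of the elements outside that class, so distinct essential subsets have distinct primes.

Upper bound: let `s` essential subsets of size `k` have union `W`, and let `D` be the product of
their primes. Outside `W` the basis lies in one class modulo `D`, yet its `h`-fold sums cover all
classes. A large number needs a summand outside `W`, so only `h - 1` summands are free and `D ≤ (s *
k + 1) ^ (h - 1)` (`IsBasisOfOrder.modulus_le`). As `D ≥ s!`, taking logarithms gives `s ≤ (1 +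
o(1)) (h - 1) log k / log log k`.

Lower bound: split primes into `H = h - 1` groups, each with product at most `k`. Take the positive
multiples of the full product together with finitely many elements that are nonzero modulo at most
one group product. This is a basis of order `H + 1`, and padding gives each prime an essential
subset of size exactly `k` (`le_numEssential_of_primes`). Chebyshev's bound supplies enough small
primes. -/

/-! ### Sumsets and integer bases. -/

theorem sumset_mono {A B : Set ℕ} (h : ℕ) (hAB : A ⊆ B) : sumset h A ⊆ sumset h B := by
  rintro n ⟨f, hf, rfl⟩
  exact ⟨f, fun i => hAB (hf i), rfl⟩

theorem mem_sumset_zero {A : Set ℕ} {n : ℕ} : n ∈ sumset 0 A ↔ n = 0 := by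
  constructor
  · rintro ⟨f, -, rfl⟩
    simp
  · rintro rfl
    exact ⟨Fin.elim0, fun i => i.elim0, by simp⟩

theorem mem_sumset_succ {A : Set ℕ} {h n : ℕ} :
    n ∈ sumset (h + 1) A ↔ ∃ a ∈ A, ∃ m ∈ sumset h A, n = a + m := by
  constructor
  · rintro ⟨f, hf, rfl⟩
    exact ⟨f 0, hf 0, _, ⟨fun i => f i.succ, fun i => hf _, rfl⟩, Fin.sum_univ_succ f⟩
  · rintro ⟨a, ha, m, ⟨f, hf, rfl⟩, rfl⟩
    refine ⟨Fin.cons a f, fun i => ?_, by simp [Fin.sum_univ_succ]⟩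
    refine Fin.cases ?_ (fun j => ?_) i
    · simpa using ha
    · simpa using hf j

theorem add_mem_sumset {A : Set ℕ} {i j m n : ℕ} (hm : m ∈ sumset i A) (hn : n ∈ sumset j A) :
    m + n ∈ sumset (i + j) A := by
  induction i generalizing m with
  | zero => rw [mem_sumset_zero] at hm; simpa [hm] using hn
  | succ i ih =>
    obtain ⟨a, ha, m', hm', rfl⟩ := mem_sumset_succ.1 hm
    rw [show i + 1 + j = i + j + 1 by ring]
    exact mem_sumset_succ.2 ⟨a, ha, m' + n, ih hm', by ring⟩

theorem mul_mem_sumset {A : Set ℕ} {i n : ℕ} (j : ℕ) (hn : n ∈ sumset i A) :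
    j * n ∈ sumset (j * i) A := by
  induction j with
  | zero => simp [mem_sumset_zero]
  | succ j ih =>
    rw [Nat.succ_mul, Nat.succ_mul]
    exact add_mem_sumset ih hn

theorem mul_mem_sumset_of_mem {A : Set ℕ} {a : ℕ} (j : ℕ) (ha : a ∈ A) : j * a ∈ sumset j A := by
  have : a ∈ sumset 1 A := mem_sumset_succ.2 ⟨a, ha, 0, mem_sumset_zero.2 rfl, rfl⟩
  simpa using mul_mem_sumset j this

theorem exists_add_of_mem_sumset_union {B C : Set ℕ} {h n : ℕ} (hn : n ∈ sumset h (B ∪ C)) :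
    ∃ i j, i + j = h ∧ ∃ b ∈ sumset i B, ∃ c ∈ sumset j C, n = b + c := by
  induction h generalizing n with
  | zero =>
    rw [mem_sumset_zero] at hn
    exact ⟨0, 0, rfl, 0, mem_sumset_zero.2 rfl, 0, mem_sumset_zero.2 rfl, hn⟩
  | succ h ih =>
    obtain ⟨a, ha, m, hm, rfl⟩ := mem_sumset_succ.1 hn
    obtain ⟨i, j, rfl, b, hb, c, hc, rfl⟩ := ih hm
    rcases ha with ha | ha
    · exact ⟨i + 1, j, by ring, a + b, mem_sumset_succ.2 ⟨a, ha, b, hb, rfl⟩, c, hc, by ring⟩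
    · exact ⟨i, j + 1, by ring, b, hb, a + c, mem_sumset_succ.2 ⟨a, ha, c, hc, rfl⟩, by ring⟩

theorem le_of_mem_sumset {A : Set ℕ} {M h n : ℕ} (hA : ∀ a ∈ A, a ≤ M) (hn : n ∈ sumset h A) :
    n ≤ h * M := by
  obtain ⟨f, hf, rfl⟩ := hn
  calc ∑ i, f i ≤ ∑ _i : Fin h, M := Finset.sum_le_sum fun i _ => hA _ (hf i)
    _ = h * M := by simp

theorem almostAll_iff {B : Set ℕ} : AlmostAll B ↔ ∃ N, ∀ n, N ≤ n → n ∈ B := by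
  constructor
  · intro h
    obtain ⟨N, hN⟩ := h.bddAbove
    refine ⟨N + 1, fun n hn => ?_⟩
    by_contra hnB
    have := hN (show n ∈ {n : ℕ | 0 < n ∧ n ∉ B} from ⟨by omega, hnB⟩)
    omega
  · rintro ⟨N, hN⟩
    refine (Set.finite_lt_nat N).subset fun n hn => ?_
    by_contra hlt
    exact hn.2 (hN n (not_lt.1 hlt))

/-- The least admissible `h` is the exact order; it is nonzero because the empty sum gives only `0`.
-/
theorem isIntegerBasis_iff {A : Set ℕ} :
    IsIntegerBasis A ↔ (∀ a ∈ A, 0 < a) ∧ ∃ h, AlmostAll (sumset h A) := by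
  classical
  constructor
  · rintro ⟨h, hA⟩
    exact ⟨hA.pos_of_mem, h, hA.almostAll⟩
  · rintro ⟨hpos, hex⟩
    have hne : Nat.find hex ≠ 0 := by
      intro h0
      obtain ⟨N, hN⟩ := almostAll_iff.1 (Nat.find_spec hex)
      rw [h0] at hN
      have := mem_sumset_zero.1 (hN (N + 1) (by omega))
      omega
    exact ⟨Nat.find hex, hpos, Nat.pos_of_ne_zero hne, Nat.find_spec hex,
      Nat.find_min hex (by omega)⟩

theorem IsIntegerBasis.infinite {A : Set ℕ} (hA : IsIntegerBasis A) : A.Infinite := by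
  intro hfin
  obtain ⟨-, h, hh⟩ := isIntegerBasis_iff.1 hA
  obtain ⟨N, hN⟩ := almostAll_iff.1 hh
  obtain ⟨M, hM⟩ := hfin.bddAbove
  have := le_of_mem_sumset (fun a ha => hM ha) (hN (N + h * M + 1) (by omega))
  omega

/-! ### Removing finite sets and the congruence obstruction. -/

theorem modEq_of_mem_sumset {B : Set ℕ} {p : ℕ} (hB : ∀ x ∈ B, ∀ y ∈ B, x ≡ y [MOD p])
    {h m n : ℕ} (hm : m ∈ sumset h B) (hn : n ∈ sumset h B) : m ≡ n [MOD p] := by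
  induction h generalizing m n with
  | zero => rw [mem_sumset_zero] at hm hn; rw [hm, hn]
  | succ h ih =>
    obtain ⟨a, ha, m', hm', rfl⟩ := mem_sumset_succ.1 hm
    obtain ⟨b, hb, n', hn', rfl⟩ := mem_sumset_succ.1 hn
    exact (hB a ha b hb).add (ih hm' hn')

theorem not_isIntegerBasis_of_modEq {B : Set ℕ} {p : ℕ} (hp : p.Prime)
    (hB : ∀ x ∈ B, ∀ y ∈ B, x ≡ y [MOD p]) : ¬ IsIntegerBasis B := by
  intro h
  obtain ⟨-, h, hh⟩ := isIntegerBasis_iff.1 h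
  obtain ⟨N, hN⟩ := almostAll_iff.1 hh
  have := modEq_of_mem_sumset hB (hN N le_rfl) (hN (N + 1) (by omega))
  have hdvd := (Nat.modEq_iff_dvd' (by omega)).1 this
  rw [Nat.add_sub_cancel_left, Nat.dvd_one] at hdvd
  exact hp.one_lt.ne' hdvd

/-- The subgroup of `ℤ` generated by the differences of elements of `B`. -/
def differenceSubgroup (B : Set ℕ) : AddSubgroup ℤ :=
  AddSubgroup.closure {z | ∃ x ∈ B, ∃ y ∈ B, z = (x : ℤ) - y}

theorem exists_sumset_of_mem_differenceSubgroup {B : Set ℕ} {z : ℤ}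
    (hz : z ∈ differenceSubgroup B) :
    ∃ m, ∃ u ∈ sumset m B, ∃ v ∈ sumset m B, z = (u : ℤ) - v := by
  induction hz using AddSubgroup.closure_induction with
  | mem z hz =>
    obtain ⟨x, hx, y, hy, rfl⟩ := hz
    exact ⟨1, x, by simpa using mul_mem_sumset_of_mem 1 hx, y,
      by simpa using mul_mem_sumset_of_mem 1 hy, rfl⟩
  | zero => exact ⟨0, 0, mem_sumset_zero.2 rfl, 0, mem_sumset_zero.2 rfl, by simp⟩
  | add z w _ _ hz hw =>
    obtain ⟨m, u, hu, v, hv, rfl⟩ := hz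
    obtain ⟨m', u', hu', v', hv', rfl⟩ := hw
    exact ⟨m + m', u + u', add_mem_sumset hu hu', v + v', add_mem_sumset hv hv',
      by push_cast; ring⟩
  | neg z _ hz =>
    obtain ⟨m, u, hu, v, hv, rfl⟩ := hz
    exact ⟨m, v, hv, u, hu, by ring⟩

theorem one_mem_differenceSubgroup_or_exists_prime (B : Set ℕ) :
    (1 : ℤ) ∈ differenceSubgroup B ∨
      ∃ p : ℕ, p.Prime ∧ ∀ x ∈ B, ∀ y ∈ B, x ≡ y [MOD p] := by
  obtain ⟨g, hg⟩ := Int.subgroup_cyclic (differenceSubgroup B)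
  rw [← AddSubgroup.zmultiples_eq_closure] at hg
  by_cases h1 : g.natAbs = 1
  · left
    rw [hg, Int.mem_zmultiples_iff]
    exact Int.natAbs_dvd.1 (by simp [h1])
  · right
    -- This also covers `g = 0`, which every prime divides.
    obtain ⟨p, hp, hpg⟩ := Nat.exists_prime_and_dvd h1
    refine ⟨p, hp, fun x hx y hy => ?_⟩
    have hmem : (y : ℤ) - x ∈ differenceSubgroup B :=
      AddSubgroup.subset_closure ⟨y, hy, x, hx, rfl⟩
    rw [hg, Int.mem_zmultiples_iff] at hmem
    exact (Nat.modEq_iff_dvd).2 ((Int.natCast_dvd.2 hpg).trans hmem)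

/-- Removing a finite set from a basis leaves a basis as soon as the differences of the remaining
elements generate `ℤ`. -/
theorem IsIntegerBasis.diff_of_one_mem {A : Set ℕ} (hA : IsIntegerBasis A) (F : Finset ℕ)
    (h1 : (1 : ℤ) ∈ differenceSubgroup (A \ (F : Set ℕ))) :
    IsIntegerBasis (A \ (F : Set ℕ)) := by
  obtain ⟨hpos, h, hh⟩ := isIntegerBasis_iff.1 hA
  refine isIntegerBasis_iff.2 ⟨fun a ha => hpos a ha.1, ?_⟩
  obtain ⟨N, hN⟩ := almostAll_iff.1 hh
  obtain ⟨m, u, hu, v, hv, huv⟩ := exists_sumset_of_mem_differenceSubgroup h1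
  obtain rfl : u = v + 1 := by omega
  obtain ⟨b₀, hb₀⟩ := (hA.infinite.sdiff F.finite_toSet).nonempty
  set B := A \ (F : Set ℕ) with hB
  obtain ⟨M, hM⟩ := F.finite_toSet.bddAbove
  set K := h * M + h * b₀ with hK
  have hAB : A ⊆ B ∪ F := by rw [hB, Set.sdiff_union_self]; exact Set.subset_union_left
  -- Replacing the summands from `F` by copies of `b₀` changes the sum by at most `K`.
  have syndetic : ∀ n, N ≤ n → ∃ w ∈ sumset h B, w ≤ n + K ∧ n ≤ w + K := by
    intro n hn
    obtain ⟨i, j, hij, b, hb, c, hc, rfl⟩ :=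
      exists_add_of_mem_sumset_union (sumset_mono h hAB (hN n hn))
    have hcM : c ≤ h * M := (le_of_mem_sumset (fun a ha => hM ha) hc).trans
      (Nat.mul_le_mul_right _ (by omega))
    have hj : j * b₀ ≤ h * b₀ := Nat.mul_le_mul_right _ (by omega)
    refine ⟨b + j * b₀, hij ▸ add_mem_sumset hb (mul_mem_sumset_of_mem j hb₀), ?_, ?_⟩ <;> omega
  refine ⟨h + 2 * K * m, almostAll_iff.2 ⟨N + K + 2 * K * v, fun n hn => ?_⟩⟩
  -- The remaining error `e` lies between `0` and `2 * K`. It is corrected by adding `e` copies of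
  -- `v + 1` and `2 * K - e` copies of `v`, so the number of summands does not depend on `n`.
  obtain ⟨w, hw, hw1, hw2⟩ := syndetic (n - 2 * K * v - K) (by omega)
  obtain ⟨e, he⟩ : ∃ e, n = w + 2 * K * v + e := ⟨n - (w + 2 * K * v), by omega⟩
  have hint : e * (v + 1) + (2 * K - e) * v ∈ sumset (2 * K * m) B := by
    have := add_mem_sumset (mul_mem_sumset e hu) (mul_mem_sumset (2 * K - e) hv)
    rwa [← Nat.add_mul, Nat.add_sub_cancel' (by omega)] at this
  have hsum : e * (v + 1) + (2 * K - e) * v = 2 * K * v + e := by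
    obtain ⟨d, hd⟩ : ∃ d, 2 * K = e + d := ⟨2 * K - e, by omega⟩
    rw [hd, Nat.add_sub_cancel_left]
    ring
  rw [he, Nat.add_assoc, ← hsum]
  exact add_mem_sumset hw hint

theorem IsIntegerBasis.not_diff_iff {A : Set ℕ} (hA : IsIntegerBasis A) (F : Finset ℕ) :
    ¬ IsIntegerBasis (A \ (F : Set ℕ)) ↔
      ∃ p : ℕ, p.Prime ∧ ∀ x ∈ A \ (F : Set ℕ), ∀ y ∈ A \ (F : Set ℕ), x ≡ y [MOD p] := by
  constructor
  · intro h
    exact (one_mem_differenceSubgroup_or_exists_prime _).resolve_left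
      fun h1 => h (hA.diff_of_one_mem F h1)
  · rintro ⟨p, hp, hB⟩
    exact not_isIntegerBasis_of_modEq hp hB


/-! ### Bounding the number of essential subsets. -/

/-- An essential subset is the complement of a residue class modulo some prime. -/
theorem IsEssentialSubset.exists_prime {A : Set ℕ} (hA : IsIntegerBasis A) {E : Finset ℕ}
    (hE : IsEssentialSubset A E) :
    ∃ p : ℕ, p.Prime ∧ ∀ y ∈ A \ (E : Set ℕ), ∀ x ∈ A, x ∈ E ↔ ¬ x ≡ y [MOD p] := by
  obtain ⟨p, hp, hcong⟩ := (hA.not_diff_iff E).1 hE.prop.2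
  refine ⟨p, hp, fun y hy x hx => ⟨fun hxE hxy => ?_, fun hxy => ?_⟩⟩
  · have hall : ∀ z ∈ A \ ((E.erase x : Finset ℕ) : Set ℕ), z ≡ y [MOD p] := by
      rintro z ⟨hzA, hz⟩
      by_cases hzx : z = x
      · rwa [hzx]
      · refine hcong z ⟨hzA, fun hzE => hz ?_⟩ y hy
        simpa [hzx] using hzE
    have hnot : ¬ IsIntegerBasis (A \ ((E.erase x : Finset ℕ) : Set ℕ)) :=
      not_isIntegerBasis_of_modEq hp fun z hz w hw => (hall z hz).trans (hall w hw).symm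
    have hsub : ((E.erase x : Finset ℕ) : Set ℕ) ⊆ A :=
      fun z hz => hE.prop.1 (Finset.mem_of_mem_erase hz)
    exact Finset.notMem_erase x E (hE.le_of_le ⟨hsub, hnot⟩ (Finset.erase_subset _ _) hxE)
  · by_contra hxE
    exact hxy (hcong x ⟨hx, hxE⟩ y hy)

theorem factorial_card_le_prod (S : Finset ℕ) (hS : ∀ x ∈ S, 0 < x) :
    S.card.factorial ≤ ∏ x ∈ S, x := by
  induction S using Finset.induction_on_max with
  | empty => simp
  | insert a S hmax ih =>
    have ha : a ∉ S := fun h => (hmax a h).false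
    rw [Finset.card_insert_of_notMem ha, Finset.prod_insert ha, Nat.factorial_succ]
    refine Nat.mul_le_mul ?_ (ih fun x hx => hS x (Finset.mem_insert_of_mem hx))
    have hsub : S ⊆ Finset.Ioo 0 a := fun x hx =>
      Finset.mem_Ioo.2 ⟨hS x (Finset.mem_insert_of_mem hx), hmax x hx⟩
    have := Finset.card_le_card hsub
    have := hS a (Finset.mem_insert_self _ _)
    rw [Nat.card_Ioo] at *
    omega

/-- If `A` covers all residues modulo `D` and all elements of `A` outside `W` lie in a single
class modulo `D`, then `D` is bounded in terms of the size of `W`. -/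
theorem IsBasisOfOrder.modulus_le {A : Set ℕ} {h : ℕ} (hA : IsBasisOfOrder A h) {D : ℕ}
    (hD : 0 < D) (W : Finset ℕ) {y : ℕ}
    (hW : ∀ x ∈ A \ (W : Set ℕ), x ≡ y [MOD D]) : D ≤ (W.card + 1) ^ (h - 1) := by
  classical
  have : NeZero D := ⟨hD.ne'⟩
  set S : Finset (ZMod D) := insert (y : ZMod D) (W.image (fun n : ℕ => (n : ZMod D))) with hS
  have hcast : ∀ a ∈ A, (a : ZMod D) ∈ S := by
    intro a ha
    by_cases haW : a ∈ W
    · exact Finset.mem_insert_of_mem (Finset.mem_image_of_mem _ haW)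
    · rw [(ZMod.natCast_eq_natCast_iff a y D).2 (hW a ⟨ha, haW⟩)]
      exact Finset.mem_insert_self _ _
  have hScard : S.card ≤ W.card + 1 :=
    (Finset.card_insert_le _ _).trans (Nat.add_le_add_right Finset.card_image_le 1)
  obtain ⟨N, hN⟩ := almostAll_iff.1 hA.almostAll
  obtain ⟨M, hM⟩ := W.finite_toSet.bddAbove
  have hAW : A ⊆ (A \ (W : Set ℕ)) ∪ W := by
    rw [Set.sdiff_union_self]
    exact Set.subset_union_left
  have hsurj : Function.Surjective
      (fun f : Fin (h - 1) → S => ∑ i, ((f i : S) : ZMod D)) := by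
    intro r
    -- The target is shifted by `y` to pay for one summand outside `W`; being larger than `h * M`,
    -- `n` must have such a summand.
    set n := (r + y).val + D * (N + h * M + 1) with hn
    have hnbig : N + h * M + 1 ≤ n := by
      have := Nat.le_mul_of_pos_left (N + h * M + 1) hD
      omega
    have hnr : (n : ZMod D) = r + y := by simp [hn]
    obtain ⟨i, j, hij, b, hb, c, hc, hbc⟩ :=
      exists_add_of_mem_sumset_union (sumset_mono h hAW (hN n (by omega)))
    have hcM : c ≤ h * M := (le_of_mem_sumset (fun a ha => hM ha) hc).trans
      (Nat.mul_le_mul_right _ (by omega))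
    obtain _ | i := i
    · rw [mem_sumset_zero] at hb
      omega
    obtain ⟨a, ha, b', hb', rfl⟩ := mem_sumset_succ.1 hb
    obtain ⟨f, hf, hfsum⟩ : b' + c ∈ sumset (h - 1) {n : ℕ | (n : ZMod D) ∈ S} := by
      rw [show h - 1 = i + j by omega]
      have hWS : (W : Set ℕ) ⊆ {n : ℕ | (n : ZMod D) ∈ S} := fun x hx =>
        Finset.mem_insert_of_mem (Finset.mem_image_of_mem (fun n : ℕ => (n : ZMod D)) hx)
      exact add_mem_sumset (sumset_mono i (fun x hx => hcast x hx.1) hb') (sumset_mono j hWS hc)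
    refine ⟨fun k => ⟨(f k : ZMod D), hf k⟩, ?_⟩
    have hay : (a : ZMod D) = y := (ZMod.natCast_eq_natCast_iff a y D).2 (hW a ha)
    have hcalc : (a : ZMod D) + ((b' + c : ℕ) : ZMod D) = r + y := by
      rw [← hnr, hbc]
      push_cast
      ring
    rw [hay, add_comm, ← hfsum] at hcalc
    simpa using add_right_cancel hcalc
  have := Fintype.card_le_of_surjective _ hsurj
  rw [ZMod.card, Fintype.card_fun, Fintype.card_coe, Fintype.card_fin] at this
  exact this.trans (Nat.pow_le_pow_left hScard _)

/-- Distinct essential subsets have distinct primes, so their product is at least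
`T.card.factorial`; `modulus_le` applied to the union of the subsets bounds it above. -/
theorem IsBasisOfOrder.factorial_card_le {A : Set ℕ} {h k : ℕ} (hA : IsBasisOfOrder A h)
    (T : Finset (Finset ℕ)) (hT : ∀ E ∈ T, IsEssentialSubset A E ∧ E.card = k) :
    T.card.factorial ≤ (T.card * k + 1) ^ (h - 1) := by
  classical
  have hA' : IsIntegerBasis A := ⟨h, hA⟩
  have hex : ∀ E : Finset ℕ, ∃ p : ℕ, E ∈ T →
      p.Prime ∧ ∀ y ∈ A \ (E : Set ℕ), ∀ x ∈ A, x ∈ E ↔ ¬ x ≡ y [MOD p] := by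
    intro E
    by_cases hE : E ∈ T
    · obtain ⟨p, hp⟩ := (hT E hE).1.exists_prime hA'
      exact ⟨p, fun _ => hp⟩
    · exact ⟨0, fun h => absurd h hE⟩
  choose p hp using hex
  set W := T.biUnion id with hW
  have hsub : ∀ E ∈ T, E ⊆ W := fun E hE => Finset.subset_biUnion_of_mem id hE
  have hWcard : W.card ≤ T.card * k :=
    Finset.card_biUnion_le_card_mul _ _ _ fun E hE => (hT E hE).2.le
  obtain ⟨y, hyA, hyW⟩ := (hA'.infinite.sdiff W.finite_toSet).nonempty
  have hy : ∀ E ∈ T, y ∈ A \ (E : Set ℕ) := fun E hE => ⟨hyA, fun h => hyW (hsub E hE h)⟩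
  have hinj : Set.InjOn p (T : Set (Finset ℕ)) := by
    intro E hE E' hE' hEE'
    ext x
    constructor
    · intro hx
      have hxA := (hT E hE).1.prop.1 hx
      rw [(hp E' hE').2 y (hy E' hE') x hxA, ← hEE', ← (hp E hE).2 y (hy E hE) x hxA]
      exact hx
    · intro hx
      have hxA := (hT E' hE').1.prop.1 hx
      rw [(hp E hE).2 y (hy E hE) x hxA, hEE', ← (hp E' hE').2 y (hy E' hE') x hxA]
      exact hx
  have hmod : ∀ x ∈ A \ (W : Set ℕ), x ≡ y [MOD ∏ E ∈ T, p E] := by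
    rintro x ⟨hxA, hxW⟩
    rw [Nat.modEq_iff_dvd]
    push_cast
    refine Finset.prod_dvd_of_coprime ?_ ?_
    · intro E hE E' hE' hne
      exact Nat.isCoprime_iff_coprime.2 ((Nat.coprime_primes (hp E hE).1 (hp E' hE').1).2
        fun h => hne (hinj hE hE' h))
    · intro E hE
      rw [← Nat.modEq_iff_dvd]
      by_contra hxy
      exact hxW (hsub E hE (((hp E hE).2 y (hy E hE) x hxA).2 hxy))
  calc T.card.factorial = (T.image p).card.factorial := by rw [Finset.card_image_of_injOn hinj]
    _ ≤ ∏ x ∈ T.image p, x := factorial_card_le_prod _ (by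
        intro x hx
        obtain ⟨E, hE, rfl⟩ := Finset.mem_image.1 hx
        exact (hp E hE).1.pos)
    _ = ∏ E ∈ T, p E := Finset.prod_image hinj
    _ ≤ (W.card + 1) ^ (h - 1) :=
        hA.modulus_le (Finset.prod_pos fun E hE => (hp E hE).1.pos) W hmod
    _ ≤ (T.card * k + 1) ^ (h - 1) := Nat.pow_le_pow_left (Nat.add_le_add_right hWcard 1) _

theorem exists_pow_lt_factorial (k m : ℕ) : ∃ s : ℕ, (s * k + 1) ^ m < s.factorial := by
  have hpos : (0 : ℝ) < 1 / ((k : ℝ) + 1) ^ m := by positivity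
  obtain ⟨s, hs, hs1⟩ := (((FloorSemiring.tendsto_pow_div_factorial_atTop ((2 : ℝ) ^ m)).eventually
    (gt_mem_nhds hpos)).and (Filter.eventually_ge_atTop 1)).exists
  refine ⟨s, ?_⟩
  rw [div_lt_div_iff₀ (by positivity) (by positivity), one_mul, ← pow_mul, mul_comm m s, pow_mul,
    ← mul_pow] at hs
  have h2 : s * k + 1 ≤ 2 ^ s * (k + 1) := by
    have := (Nat.lt_two_pow_self (n := s)).le
    nlinarith
  calc (s * k + 1) ^ m ≤ (2 ^ s * (k + 1)) ^ m := Nat.pow_le_pow_left h2 _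
    _ < s.factorial := by exact_mod_cast hs

/-- A uniform bound for the number of essential subsets of size `k`. -/
theorem exists_numEssential_le (h k : ℕ) :
    ∃ s : ℕ, ∀ A, IsBasisOfOrder A h → numEssential A k ≤ s := by
  obtain ⟨s, hs⟩ := exists_pow_lt_factorial k (h - 1)
  refine ⟨s, fun A hA => ?_⟩
  by_contra hlt
  obtain ⟨T, hTsub, hTcard⟩ := Set.exists_subset_encard_eq (not_le.1 hlt).le
  have hfin : T.Finite := Set.finite_of_encard_eq_coe hTcard
  have := hA.factorial_card_le (k := k) hfin.toFinset fun E hE => hTsub (by simpa using hE)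
  rw [hfin.encard_eq_coe_toFinset_card, Nat.cast_inj] at hTcard
  rw [hTcard] at this
  exact this.not_gt hs

/-! ### Existence of the maximum. -/

/-- Bases of every order exist, so the supremum is over a nonempty set. The residue `h - 1` forces
`h - 1` ones, and large numbers in that class need a further summand. -/
theorem isBasisOfOrder_insert_one {h : ℕ} (hh : 0 < h) :
    IsBasisOfOrder (insert 1 {n | 0 < n ∧ h ∣ n}) h where
  pos_of_mem := by
    rintro a (rfl | ha)
    · exact one_pos
    · exact ha.1
  order_pos := hh
  almostAll := by
    refine almostAll_iff.2 ⟨h * h + h, fun n hn => ?_⟩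
    have hlt := Nat.mod_lt n hh
    have hdiv := Nat.div_add_mod n h
    -- The `h` summands are `n % h` ones, `d` copies of `h` and one large multiple of `h`.
    obtain ⟨d, hd⟩ : ∃ d, h = n % h + (d + 1) := ⟨h - n % h - 1, by omega⟩
    obtain ⟨q, hq⟩ : ∃ q, n / h = d + (q + 1) := by
      have : h + 1 ≤ n / h := by
        rw [Nat.le_div_iff_mul_le hh]
        linarith
      exact ⟨n / h - d - 1, by omega⟩
    have h1 := mul_mem_sumset_of_mem (A := insert 1 {n | 0 < n ∧ h ∣ n}) (n % h)
      (Set.mem_insert _ _)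
    have h2 := mul_mem_sumset_of_mem (A := insert 1 {n | 0 < n ∧ h ∣ n}) d
      (Set.mem_insert_of_mem _ ⟨hh, dvd_rfl⟩)
    have h3 := mem_sumset_succ.2 ⟨h * (q + 1),
      Set.mem_insert_of_mem 1 (show h * (q + 1) ∈ {n | 0 < n ∧ h ∣ n} from
        ⟨by positivity, dvd_mul_right _ _⟩), _, h2, rfl⟩
    have h4 := add_mem_sumset h1 h3
    rw [← hd] at h4
    convert h4 using 1
    rw [← hdiv, hq]
    simp only [Nat.mul_add_mod, Nat.mod_mod]
    ring
  not_almostAll := by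
    intro hall
    obtain ⟨N, hN⟩ := almostAll_iff.1 hall
    have hmem := hN (h * (N + 1) + (h - 1)) (by nlinarith)
    obtain ⟨i, j, hij, b, hb, c, hc, hbc⟩ := exists_add_of_mem_sumset_union
      (B := {n | 0 < n ∧ h ∣ n}) (C := {1}) (sumset_mono _ (by rw [Set.union_comm]; rfl) hmem)
    have hcj : c ≤ j := by simpa using le_of_mem_sumset (M := 1) (by simp) hc
    have hbmod : h ∣ b := by
      obtain ⟨f, hf, rfl⟩ := hb
      exact Finset.dvd_sum fun i _ => (hf i).2
    have hcong : h - 1 ≡ c [MOD h] := by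
      have h1 : h * (N + 1) + (h - 1) ≡ h - 1 [MOD h] := by
        simp [Nat.ModEq]
      have h2 : b + c ≡ c [MOD h] := by
        obtain ⟨d, rfl⟩ := hbmod
        simp [Nat.ModEq]
      rw [hbc] at h1
      exact h1.symm.trans h2
    have hc' := Nat.ModEq.eq_of_lt_of_lt hcong (by omega) (by omega)
    obtain rfl : i = 0 := by omega
    rw [mem_sumset_zero] at hb
    have : 0 < h * (N + 1) := by positivity
    omega

theorem isGreatest_maxEssential {h : ℕ} (hh : 0 < h) (k : ℕ) :
    IsGreatest (essentialCounts h k) (maxEssential h k : ℕ∞) := by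
  obtain ⟨s, hs⟩ := exists_numEssential_le h k
  have hle : sSup (essentialCounts h k) ≤ s := by
    refine sSup_le ?_
    rintro _ ⟨A, hA, rfl⟩
    exact hs A hA
  have hlt : sSup (essentialCounts h k) < ⊤ := hle.trans_lt (ENat.natCast_lt_top s)
  have hne : Nonempty (essentialCounts h k) := ⟨_, _, isBasisOfOrder_insert_one hh, rfl⟩
  rw [maxEssential, ENat.natCast_toNat hlt.ne]
  exact ⟨ENat.sSup_mem_of_nonempty_of_lt_top hlt, fun x hx => le_sSup hx⟩

theorem factorial_le_of_le_maxEssential {h : ℕ} (hh : 0 < h) {k s : ℕ}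
    (hs : s ≤ maxEssential h k) : s.factorial ≤ (s * k + 1) ^ (h - 1) := by
  obtain ⟨A, hA, hcount⟩ := (isGreatest_maxEssential hh k).1
  have hsA : (s : ℕ∞) ≤ numEssential A k := by
    rw [hcount]
    exact_mod_cast hs
  obtain ⟨T, hTsub, hTcard⟩ := Set.exists_subset_encard_eq hsA
  have hfin : T.Finite := Set.finite_of_encard_eq_coe hTcard
  have := hA.factorial_card_le (k := k) hfin.toFinset fun E hE => hTsub (by simpa using hE)
  rw [hfin.encard_eq_coe_toFinset_card, Nat.cast_inj] at hTcard
  rwa [hTcard] at this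


/-! ### Construction of bases with many essential subsets. -/

/-- If removing a smaller set leaves one class modulo a prime `q`, the survivors `D` and `2 * D`
force `q ∣ D` and the class `0`. For `q ≠ p` the element `w q` is a multiple of `p`, hence survives,
but is not divisible by `q`. -/
theorem isEssentialSubset_filter_not_dvd {A : Set ℕ} (hA : IsIntegerBasis A) {P G : Finset ℕ}
    (hP : ∀ p ∈ P, p.Prime) (hAG : A = {n | 0 < n ∧ (∏ p ∈ P, p) ∣ n} ∪ G) {w : ℕ → ℕ}
    (hwG : ∀ p ∈ P, w p ∈ G) (hw : ∀ p ∈ P, ¬ p ∣ w p)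
    (hw' : ∀ p ∈ P, ∀ q ∈ P, q ≠ p → q ∣ w p) {p : ℕ} (hp : p ∈ P) :
    IsEssentialSubset A {x ∈ G | ¬ p ∣ x} := by
  set D := ∏ p ∈ P, p with hD
  have hDpos : 0 < D := Finset.prod_pos fun p hp => (hP p hp).pos
  have hpD : ∀ q ∈ P, q ∣ D := fun q hq => Finset.dvd_prod_of_mem _ hq
  have hGA : (G : Set ℕ) ⊆ A := hAG ▸ Set.subset_union_right
  have hdiv : ∀ x ∈ A \ (({x ∈ G | ¬ p ∣ x} : Finset ℕ) : Set ℕ), p ∣ x := by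
    rintro x ⟨hxA, hx⟩
    rw [hAG] at hxA
    rcases hxA with hxD | hxG
    · exact (hpD p hp).trans hxD.2
    · by_contra hpx
      exact hx (by simpa using ⟨hxG, hpx⟩)
  refine ⟨⟨fun x hx => hGA (Finset.mem_filter.1 hx).1, not_isIntegerBasis_of_modEq (hP p hp)
    fun x hx y hy => ?_⟩, ?_⟩
  · exact (Nat.modEq_zero_iff_dvd.2 (hdiv x hx)).trans (Nat.modEq_zero_iff_dvd.2 (hdiv y hy)).symm
  rintro F ⟨-, hF⟩ hFE
  obtain ⟨q, hq, hcong⟩ := (hA.not_diff_iff F).1 hF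
  have hmem : ∀ x ∈ A, p ∣ x → x ∈ A \ (F : Set ℕ) := fun x hx hpx =>
    ⟨hx, fun hxF => (Finset.mem_filter.1 (hFE hxF)).2 hpx⟩
  have hDA : D ∈ A \ (F : Set ℕ) :=
    hmem D (hAG ▸ Or.inl ⟨hDpos, dvd_rfl⟩) (hpD p hp)
  have h2DA : D + D ∈ A \ (F : Set ℕ) :=
    hmem _ (hAG ▸ Or.inl ⟨by omega, dvd_add dvd_rfl dvd_rfl⟩) (dvd_add (hpD p hp) (hpD p hp))
  have hqD : q ∣ D := by
    simpa using (Nat.modEq_iff_dvd' (Nat.le_add_right D D)).1 (hcong _ hDA _ h2DA)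
  have hqdvd : ∀ x ∈ A \ (F : Set ℕ), q ∣ x := fun x hx =>
    Nat.modEq_zero_iff_dvd.1 ((hcong x hx D hDA).trans (Nat.modEq_zero_iff_dvd.2 hqD))
  have hqP : q ∈ P := by
    obtain ⟨r, hr, hqr⟩ := (Prime.dvd_finsetProd_iff hq.prime _).1 hqD
    rwa [(Nat.prime_dvd_prime_iff_eq hq (hP r hr)).1 hqr]
  obtain rfl : p = q := by
    by_contra hpq
    exact hw q hqP (hqdvd _ (hmem _ (hGA (hwG q hqP)) (hw' q hqP p hp hpq)))
  intro x hx
  obtain ⟨hxG, hpx⟩ := Finset.mem_filter.1 hx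
  by_contra hxF
  exact hpx (hqdvd x ⟨hGA hxG, hxF⟩)

/-- The product of all moduli except the `j`-th one. -/
def cofactor {H : ℕ} (N : Fin H → ℕ) (j : Fin H) : ℕ := ∏ i ∈ {j}ᶜ, N i

theorem mul_cofactor {H : ℕ} (N : Fin H → ℕ) (j : Fin H) : N j * cofactor N j = ∏ i, N i :=
  (Fintype.prod_eq_mul_prod_compl j N).symm

theorem dvd_cofactor {H : ℕ} (N : Fin H → ℕ) {i j : Fin H} (hij : i ≠ j) : N i ∣ cofactor N j :=
  Finset.dvd_prod_of_mem _ (by simpa using hij)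

/-- Pairwise coprimality gives a Bézout relation among the cofactors. Multiply it by `n` and reduce
the `j`-th coefficient modulo `N j`. -/
theorem exists_sum_cofactor_modEq {H : ℕ} (hH : 0 < H) {N : Fin H → ℕ} (hN : ∀ j, 0 < N j)
    (hcop : Pairwise fun i j => (N i).Coprime (N j)) (n : ℕ) :
    ∃ y : Fin H → ℕ, (∀ j, y j < N j) ∧ ∑ j, cofactor N j * y j ≡ n [MOD ∏ j, N j] := by
  have : Nonempty (Fin H) := ⟨⟨0, hH⟩⟩
  obtain ⟨μ, hμ⟩ := (exists_sum_eq_one_iff_pairwise_coprime' (s := fun j => (N j : ℤ))).2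
    fun i j hij => Nat.isCoprime_iff_coprime.2 (hcop hij)
  have hpos : ∀ j, (0 : ℤ) < N j := fun j => by exact_mod_cast hN j
  refine ⟨fun j => ((n * μ j) % N j).toNat, fun j => ?_, ?_⟩
  · have h1 := Int.emod_lt_of_pos (n * μ j) (hpos j)
    have h2 := Int.emod_nonneg (n * μ j) (hpos j).ne'
    exact (Int.toNat_lt h2).2 h1
  · have hcast : ∀ j, ((((n * μ j) % N j).toNat : ℕ) : ℤ) = (n * μ j) % N j := fun j =>
      Int.toNat_of_nonneg (Int.emod_nonneg _ (hpos j).ne')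
    have hsum : (n : ℤ) = ∑ j, (cofactor N j : ℤ) * (n * μ j) := by
      calc (n : ℤ) = n * ∑ j, μ j * ∏ i ∈ {j}ᶜ, (N i : ℤ) := by rw [hμ, mul_one]
        _ = _ := by
          rw [Finset.mul_sum]
          refine Finset.sum_congr rfl fun j _ => ?_
          simp only [cofactor]
          push_cast
          ring
    set y : Fin H → ℕ := fun j => ((n * μ j) % N j).toNat
    have hdvd : ((∏ j, N j : ℕ) : ℤ) ∣
        ∑ j, (cofactor N j : ℤ) * (n * μ j) - ((∑ j, cofactor N j * y j : ℕ) : ℤ) := by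
      rw [Nat.cast_sum, ← Finset.sum_sub_distrib]
      refine Finset.dvd_sum fun j _ => ?_
      rw [Nat.cast_mul, hcast, ← mul_sub, ← mul_cofactor N j, Nat.cast_mul, mul_comm]
      exact mul_dvd_mul_left _ (Int.dvd_self_sub_emod)
    rwa [← hsum, ← Nat.modEq_iff_dvd] at hdvd

/-- Modulo the product, each element of `G` has at most one nonzero coordinate among the `N j`. Thus
`H` summands can fix the residue and one more adjusts the size, while a residue with all coordinates
nonzero uses up `H` elements of the finite set `G`. -/
theorem isBasisOfOrder_union {H : ℕ} (hH : 0 < H) {N : Fin H → ℕ} (hN : ∀ j, 1 < N j)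
    (hcop : Pairwise fun i j => (N i).Coprime (N j)) {G : Finset ℕ} (hpos : ∀ a ∈ G, 0 < a)
    (hG : ∀ a ∈ G, ∃ j, ∀ i, i ≠ j → N i ∣ a)
    (hmem : ∀ j, ∀ y, 0 < y → y < N j → cofactor N j * y ∈ G) :
    IsBasisOfOrder ({n | 0 < n ∧ (∏ j, N j) ∣ n} ∪ G) (H + 1) := by
  set D := ∏ j, N j with hD
  have hN0 : ∀ j, 0 < N j := fun j => one_pos.trans (hN j)
  have hDpos : 0 < D := Finset.prod_pos fun j _ => hN0 j
  refine ⟨?_, by omega, ?_, ?_⟩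
  · rintro a (ha | ha)
    · exact ha.1
    · exact hpos a ha
  · refine almostAll_iff.2 ⟨H * D + 1, fun n hn => ?_⟩
    obtain ⟨y, hy, hyn⟩ := exists_sum_cofactor_modEq hH hN0 hcop n
    -- A zero digit is represented by `D`, since `0` is not in the set.
    set z : Fin H → ℕ := fun j => if y j = 0 then D else cofactor N j * y j with hz
    have hzD : ∀ j, z j ≤ D := by
      intro j
      simp only [hz]
      split_ifs with h
      · exact le_rfl
      · rw [hD, ← mul_cofactor N j, mul_comm (N j)]
        exact Nat.mul_le_mul_left _ (hy j).le
    have hzA : ∀ j, z j ∈ {n | 0 < n ∧ D ∣ n} ∪ (G : Set ℕ) := by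
      intro j
      simp only [hz]
      split_ifs with h
      · exact Or.inl ⟨hDpos, dvd_rfl⟩
      · exact Or.inr (hmem j _ (Nat.pos_of_ne_zero h) (hy j))
    have hzmod : ∑ j, z j ≡ n [MOD D] := by
      refine Nat.ModEq.trans ?_ hyn
      rw [Nat.modEq_iff_dvd, Nat.cast_sum, Nat.cast_sum, ← Finset.sum_sub_distrib]
      refine Finset.dvd_sum fun j _ => ?_
      rw [← Nat.modEq_iff_dvd]
      simp only [hz]
      split_ifs with h
      · simp [h, Nat.ModEq]
      · rfl
    have hzsum : ∑ j, z j ≤ H * D := by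
      simpa using Finset.sum_le_sum fun j (_ : j ∈ Finset.univ) => hzD j
    refine mem_sumset_succ.2 ⟨n - ∑ j, z j, Or.inl ⟨by omega, ?_⟩, ∑ j, z j, ⟨z, hzA, rfl⟩,
      by omega⟩
    exact (Nat.modEq_iff_dvd' (by omega)).1 hzmod
  · intro hall
    obtain ⟨N₀, hN₀⟩ := almostAll_iff.1 hall
    obtain ⟨M, hM⟩ := G.finite_toSet.bddAbove
    set r := ∑ j, cofactor N j with hr
    have hbig : N₀ + H * M + 1 ≤ D * (N₀ + H * M + 1) := Nat.le_mul_of_pos_left _ hDpos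
    rw [Nat.add_sub_cancel] at hN₀
    obtain ⟨f, hf, hfsum⟩ := hN₀ (r + D * (N₀ + H * M + 1)) (by omega)
    have hex : ∀ j, ∃ i, ¬ N j ∣ f i := by
      intro j
      by_contra! hdvd
      have h1 : N j ∣ r + D * (N₀ + H * M + 1) := hfsum ▸ Finset.dvd_sum fun i _ => hdvd i
      have h2 : N j ∣ r := (Nat.dvd_add_left
        (Dvd.dvd.mul_right (Finset.dvd_prod_of_mem N (Finset.mem_univ j)) _)).1 h1
      rw [hr, ← Finset.add_sum_erase _ _ (Finset.mem_univ j)] at h2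
      have h3 : N j ∣ cofactor N j := (Nat.dvd_add_left (Finset.dvd_sum fun i hi =>
        dvd_cofactor N (Finset.ne_of_mem_erase hi).symm)).1 h2
      have h4 : (N j).Coprime (cofactor N j) := Nat.Coprime.prod_right fun i hi =>
        hcop (by simpa [eq_comm] using hi)
      exact (hN j).ne' (Nat.Coprime.eq_one_of_dvd h4 h3)
    choose g hg using hex
    have hfG : ∀ j, f (g j) ∈ G := fun j => (hf (g j)).resolve_left fun h =>
      hg j ((Finset.dvd_prod_of_mem N (Finset.mem_univ j)).trans h.2)
    have hginj : Function.Injective g := by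
      intro i j hij
      obtain ⟨l, hl⟩ := hG _ (hfG i)
      have hi : i = l := by
        by_contra h
        exact hg i (hl i h)
      have hj : j = l := by
        by_contra h
        exact hg j (hij ▸ hl j h)
      rw [hi, hj]
    have hgsurj := Finite.surjective_of_injective hginj
    have hle := le_of_mem_sumset (A := G) (fun a ha => hM ha)
      ⟨f, fun i => by obtain ⟨j, rfl⟩ := hgsurj i; exact hfG j, hfsum⟩
    omega

/-- For `p ∈ P j`, at most `N j - 1` elements of the core `C` are not divisible by `p`, whence the
condition `∏ p ∈ P j, p ≤ k`. The sets `X p` fill the deficit up to `k`. -/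
theorem le_numEssential_of_primes {H k : ℕ} (hH : 0 < H) (P : Fin H → Finset ℕ)
    (hprime : ∀ j, ∀ p ∈ P j, p.Prime) (hne : ∀ j, (P j).Nonempty)
    (hdisj : Pairwise fun i j => Disjoint (P i) (P j)) (hk : ∀ j, ∏ p ∈ P j, p ≤ k) :
    ∃ A, IsBasisOfOrder A (H + 1) ∧ ((∑ j, (P j).card : ℕ) : ℕ∞) ≤ numEssential A k := by
  classical
  set N : Fin H → ℕ := fun j => ∏ p ∈ P j, p with hN
  set Q := Finset.univ.biUnion P with hQ
  have hdisj' : (↑(Finset.univ : Finset (Fin H)) : Set (Fin H)).PairwiseDisjoint P :=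
    fun i _ j _ hij => hdisj hij
  have hprod : ∏ p ∈ Q, p = ∏ j, N j := Finset.prod_biUnion hdisj'
  have hQprime : ∀ p ∈ Q, p.Prime := by
    intro p hp
    obtain ⟨j, -, hj⟩ := Finset.mem_biUnion.1 hp
    exact hprime j p hj
  set D := ∏ j, N j with hD
  have hN1 : ∀ j, 1 < N j := by
    intro j
    obtain ⟨p, hp⟩ := hne j
    exact (hprime j p hp).one_lt.trans_le (Nat.le_of_dvd
      (Finset.prod_pos fun q hq => (hprime j q hq).pos) (Finset.dvd_prod_of_mem _ hp))
  have hDpos : 0 < D := Finset.prod_pos fun j _ => one_pos.trans (hN1 j)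
  have hcof : ∀ j, 0 < cofactor N j := fun j => Finset.prod_pos fun i _ => one_pos.trans (hN1 i)
  have hcop : Pairwise fun i j => (N i).Coprime (N j) := by
    intro i j hij
    refine Nat.Coprime.prod_left fun p hp => Nat.Coprime.prod_right fun q hq => ?_
    refine (Nat.coprime_primes (hprime i p hp) (hprime j q hq)).2 fun hpq => ?_
    exact Finset.disjoint_left.1 (hdisj hij) hp (hpq ▸ hq)
  set w : ℕ → ℕ := fun p => ∏ q ∈ Q.erase p, q with hw
  have hpw : ∀ p ∈ Q, p * w p = D := fun p hp => (Finset.mul_prod_erase Q id hp).trans hprod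
  have hw1 : ∀ p ∈ Q, ¬ p ∣ w p := by
    intro p hp hdvd
    obtain ⟨q, hq, hpq⟩ := (Prime.dvd_finsetProd_iff (hQprime p hp).prime _).1 hdvd
    exact Finset.ne_of_mem_erase hq ((Nat.prime_dvd_prime_iff_eq (hQprime p hp)
      (hQprime q (Finset.mem_of_mem_erase hq))).1 hpq).symm
  have hw2 : ∀ p ∈ Q, ∀ q ∈ Q, q ≠ p → q ∣ w p := fun p _ q hq hqp =>
    Finset.dvd_prod_of_mem _ (Finset.mem_erase.2 ⟨hqp, hq⟩)
  have hwcof : ∀ j, ∀ p ∈ P j, ∃ y, 0 < y ∧ y < N j ∧ w p = cofactor N j * y := by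
    intro j p hp
    have hpQ : p ∈ Q := Finset.mem_biUnion.2 ⟨j, Finset.mem_univ j, hp⟩
    have hy : p * ∏ q ∈ (P j).erase p, q = N j := Finset.mul_prod_erase (P j) id hp
    have hypos : 0 < ∏ q ∈ (P j).erase p, q :=
      Finset.prod_pos fun q hq => (hprime j q (Finset.mem_of_mem_erase hq)).pos
    refine ⟨_, hypos, ?_, ?_⟩
    · have := (hprime j p hp).two_le
      nlinarith
    · refine Nat.eq_of_mul_eq_mul_left (hprime j p hp).pos ?_
      rw [hpw p hpQ, mul_left_comm, hy, mul_comm, hD, mul_cofactor]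
  set T : Fin H → Finset ℕ := fun j => (Finset.Ioo 0 (N j)).image (cofactor N j * ·) with hT
  set C := Finset.univ.biUnion T with hC
  have hCmem : ∀ a, a ∈ C ↔ ∃ j y, 0 < y ∧ y < N j ∧ cofactor N j * y = a := by
    intro a
    simp [hC, hT, and_assoc]
  set c : ℕ → ℕ := fun p => Finset.card {x ∈ C | ¬ p ∣ x} with hc
  -- Padding elements are congruent to `w p` modulo `D`, so among the primes of `Q` only `p` fails
  -- to divide them; exceeding `D`, they avoid `C`.
  set X : ℕ → Finset ℕ := fun p => (Finset.range (k - c p)).image fun m => D * (m + 1) + w p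
    with hX
  set G := C ∪ Q.biUnion X with hG
  have hCG : C ⊆ G := Finset.subset_union_left
  have hwG : ∀ p ∈ Q, w p ∈ G := by
    intro p hp
    obtain ⟨j, -, hj⟩ := Finset.mem_biUnion.1 hp
    obtain ⟨y, hy0, hy1, hy⟩ := hwcof j p hj
    exact hCG ((hCmem _).2 ⟨j, y, hy0, hy1, hy.symm⟩)
  have hck : ∀ p ∈ Q, c p ≤ k := by
    intro p hp
    obtain ⟨j, -, hj⟩ := Finset.mem_biUnion.1 hp
    have hsub : ({x ∈ C | ¬ p ∣ x} : Finset ℕ) ⊆ T j := by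
      intro x hx
      obtain ⟨hxC, hpx⟩ := Finset.mem_filter.1 hx
      obtain ⟨i, -, hi⟩ := Finset.mem_biUnion.1 hxC
      obtain rfl : i = j := by
        by_contra hij
        obtain ⟨y, -, rfl⟩ := Finset.mem_image.1 hi
        exact hpx (((Finset.dvd_prod_of_mem _ hj).trans
          (dvd_cofactor N (Ne.symm hij))).mul_right y)
      exact hi
    refine (Finset.card_le_card hsub).trans (Finset.card_image_le.trans ?_)
    rw [Nat.card_Ioo]
    have := hk j
    simp only [hN]
    omega
  have hbasis : IsBasisOfOrder ({n | 0 < n ∧ D ∣ n} ∪ G) (H + 1) := by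
    refine isBasisOfOrder_union hH hN1 hcop ?_ ?_ ?_
    · intro a ha
      rcases Finset.mem_union.1 ha with ha | ha
      · obtain ⟨j, y, hy, -, rfl⟩ := (hCmem a).1 ha
        exact Nat.mul_pos (hcof j) hy
      · obtain ⟨p, -, hp⟩ := Finset.mem_biUnion.1 ha
        obtain ⟨m, -, rfl⟩ := Finset.mem_image.1 hp
        positivity
    · intro a ha
      rcases Finset.mem_union.1 ha with ha | ha
      · obtain ⟨j, y, -, -, rfl⟩ := (hCmem a).1 ha
        exact ⟨j, fun i hij => (dvd_cofactor N hij).mul_right y⟩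
      · obtain ⟨p, hpQ, hp⟩ := Finset.mem_biUnion.1 ha
        obtain ⟨m, -, rfl⟩ := Finset.mem_image.1 hp
        obtain ⟨j, -, hj⟩ := Finset.mem_biUnion.1 hpQ
        obtain ⟨y, -, -, hy⟩ := hwcof j p hj
        refine ⟨j, fun i hij => dvd_add (Dvd.dvd.mul_right
          (Finset.dvd_prod_of_mem N (Finset.mem_univ i)) _) ?_⟩
        rw [hy]
        exact (dvd_cofactor N hij).mul_right y
    · exact fun j y hy0 hy1 => hCG ((hCmem _).2 ⟨j, y, hy0, hy1, rfl⟩)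
  refine ⟨_, hbasis, ?_⟩
  have hcard : ∀ p ∈ Q, Finset.card {x ∈ G | ¬ p ∣ x} = k := by
    intro p hp
    have hpD : p ∣ D := ⟨w p, (hpw p hp).symm⟩
    have heq : ({x ∈ G | ¬ p ∣ x} : Finset ℕ) = {x ∈ C | ¬ p ∣ x} ∪ X p := by
      ext x
      simp only [hG, Finset.mem_filter, Finset.mem_union, Finset.mem_biUnion]
      constructor
      · rintro ⟨hx | ⟨q, hq, hx⟩, hpx⟩
        · exact Or.inl ⟨hx, hpx⟩
        · by_cases hqp : q = p
          · exact Or.inr (hqp ▸ hx)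
          · obtain ⟨m, -, rfl⟩ := Finset.mem_image.1 hx
            exact absurd (dvd_add (hpD.mul_right _) (hw2 q hq p hp (Ne.symm hqp))) hpx
      · rintro (⟨hx, hpx⟩ | hx)
        · exact ⟨Or.inl hx, hpx⟩
        · refine ⟨Or.inr ⟨p, hp, hx⟩, ?_⟩
          obtain ⟨m, -, rfl⟩ := Finset.mem_image.1 hx
          rw [Nat.dvd_add_right (hpD.mul_right _)]
          exact hw1 p hp
    have hdisjoint : Disjoint ({x ∈ C | ¬ p ∣ x} : Finset ℕ) (X p) := by
      rw [Finset.disjoint_left]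
      intro x hx hxX
      obtain ⟨j, y, -, hy, hxy⟩ := (hCmem x).1 (Finset.mem_filter.1 hx).1
      obtain ⟨m, -, hm⟩ := Finset.mem_image.1 hxX
      have h1 : x < D := by
        rw [← hxy, hD, ← mul_cofactor N j, mul_comm (N j)]
        exact Nat.mul_lt_mul_of_pos_left hy (hcof j)
      have h2 : D ≤ D * (m + 1) := Nat.le_mul_of_pos_right _ (by omega)
      omega
    have hXcard : (X p).card = k - c p := by
      rw [Finset.card_image_of_injective, Finset.card_range]
      intro m m' hmm
      have := Nat.eq_of_mul_eq_mul_left hDpos (Nat.add_right_cancel hmm)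
      omega
    have := hck p hp
    rw [heq, Finset.card_union_of_disjoint hdisjoint, hXcard]
    simp only [hc] at *
    omega
  set e : ℕ → Finset ℕ := fun p => {x ∈ G | ¬ p ∣ x} with he
  have hinj : Set.InjOn e Q := by
    intro p hp q hq hpq
    have hmem : w p ∈ e q := hpq ▸ Finset.mem_filter.2 ⟨hwG p hp, hw1 p hp⟩
    by_contra hne'
    exact (Finset.mem_filter.1 hmem).2 (hw2 p hp q hq (Ne.symm hne'))
  have hsub : ((Q.image e : Finset (Finset ℕ)) : Set (Finset ℕ)) ⊆
      {E : Finset ℕ | IsEssentialSubset ({n | 0 < n ∧ D ∣ n} ∪ G) E ∧ E.card = k} := by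
    intro E hE
    obtain ⟨p, hp, rfl⟩ := Finset.mem_image.1 (Finset.mem_coe.1 hE)
    exact ⟨isEssentialSubset_filter_not_dvd ⟨_, hbasis⟩ hQprime (by rw [hprod]) hwG hw1 hw2 hp,
      hcard p hp⟩
  have hle := Set.encard_le_encard hsub
  rwa [Set.encard_coe_eq_coe_finsetCard, Finset.card_image_of_injOn hinj,
    Finset.card_biUnion hdisj'] at hle


/-! ### Asymptotic lower bound. -/

theorem mul_le_maxEssential {H t x k : ℕ} (hH : 0 < H) (ht : 0 < t)
    (hx : H * t ≤ Nat.primeCounting x) (hk : x ^ t ≤ k) : H * t ≤ maxEssential (H + 1) k := by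
  classical
  have hinf : (Set.ofPred Nat.Prime).Infinite := Nat.infinite_setOfPred_prime
  set e : Fin H × Fin t → ℕ := fun i => Nat.nth Nat.Prime (finProdFinEquiv i) with he
  have heinj : Function.Injective e := fun i j hij =>
    finProdFinEquiv.injective (Fin.ext (Nat.nth_injective hinf hij))
  have hele : ∀ i, e i ≤ x := fun i => Nat.lt_succ_iff.1
    (Nat.nth_lt_of_lt_count ((finProdFinEquiv i).isLt.trans_le hx))
  set P : Fin H → Finset ℕ := fun j => Finset.univ.image fun i => e (j, i) with hP
  have hcard : ∀ j, (P j).card = t := by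
    intro j
    rw [Finset.card_image_of_injective _ fun i i' hii => (Prod.mk.inj (heinj hii)).2]
    simp
  obtain ⟨A, hA, hle⟩ := le_numEssential_of_primes (k := k) hH P
    (by
      intro j p hp
      obtain ⟨i, -, rfl⟩ := Finset.mem_image.1 hp
      exact Nat.nth_mem_of_infinite hinf _)
    (fun j => Finset.card_pos.1 ((hcard j).symm ▸ ht))
    (by
      intro j j' hjj
      refine Finset.disjoint_left.2 fun p hp hp' => hjj ?_
      obtain ⟨i, -, rfl⟩ := Finset.mem_image.1 hp
      obtain ⟨i', -, hi'⟩ := Finset.mem_image.1 hp'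
      exact (Prod.mk.inj (heinj hi')).1.symm)
    (by
      intro j
      refine le_trans ?_ hk
      rw [← hcard j]
      refine Finset.prod_le_pow_card _ _ _ fun p hp => ?_
      obtain ⟨i, -, rfl⟩ := Finset.mem_image.1 hp
      exact hele _)
  have hmax := (isGreatest_maxEssential (Nat.succ_pos H) k).2 ⟨A, hA, rfl⟩
  have := hle.trans hmax
  simp only [hcard, Finset.sum_const, Finset.card_univ, Fintype.card_fin, smul_eq_mul] at this
  exact_mod_cast this

open Filter Real Asymptotics

/-- The exponent `a > 1` leaves a power of `L` to spare, so a Chebyshev bound suffices. In the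
constant, `H + 2` is the main `H` plus `2` for absorbing `log (x + 2)`. -/
theorem eventually_mul_le_primeCounting_rpow (H : ℕ) {a : ℝ} (ha : 1 < a) :
    ∀ᶠ L : ℝ in atTop, H * L ≤ Nat.primeCounting ⌊L ^ a⌋₊ := by
  have hε : (0 : ℝ) < 1 / (4 * (H + 2) * a) := by positivity
  filter_upwards [(isLittleO_log_rpow_atTop (sub_pos.2 ha)).bound hε, eventually_ge_atTop 2]
    with L hL hL2
  have hL0 : 0 < L := by linarith
  have hlogL : 0 < log L := log_pos (by linarith)
  rw [norm_of_nonneg hlogL.le, norm_of_nonneg (rpow_nonneg hL0.le _), rpow_sub_one hL0.ne',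
    mul_div_assoc', one_div_mul_eq_div, div_div, le_div_iff₀ (by positivity)] at hL
  set x := L ^ a with hx
  have hLx : L ≤ x := by simpa using rpow_le_rpow_of_exponent_le (by linarith) ha.le
  have hlogx : log x = a * log L := log_rpow hL0 a
  have hlogxpos : 0 < log x := by rw [hlogx]; positivity
  refine le_trans ?_ (Chebyshev.pi_ge' (by linarith : 1 < x))
  rw [le_div_iff₀ hlogxpos]
  have h1 : log (x + 2) ≤ 2 * log x := by
    have : log (x ^ 2) = 2 * log x := by rw [log_pow]; norm_num
    rw [← this]
    exact log_le_log (by linarith) (by nlinarith)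
  have h2 : 2 * log x ≤ 2 * (L * log x) := by nlinarith
  have h3 : (x - 1) * log 2 ≥ x / 4 := by nlinarith [log_two_gt_d9]
  have h4 : (H + 2) * (L * log x) ≤ x / 4 := by
    rw [hlogx]
    linarith
  linarith

theorem eventually_le_maxEssential {H : ℕ} (hH : 0 < H) {c : ℝ} (hc : 0 < c) :
    ∀ᶠ k : ℕ in atTop,
      (1 - c) * (H * (log k / log (log k))) ≤ (maxEssential (H + 1) k : ℝ) := by
  set a := 1 + c with ha
  have ha1 : 1 < a := by linarith
  have hlog : Tendsto (fun k : ℕ => log (k : ℝ)) atTop atTop :=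
    tendsto_log_atTop.comp tendsto_natCast_atTop_atTop
  -- The first term makes `t` positive; the second pays for the floor, as `1 / a - c ^ 2 / a = 1 -
  -- c`.
  set η := min (1 / a) (c ^ 2 / a) with hη
  have hηpos : 0 < η := lt_min (by positivity) (by positivity)
  have hmain : ∀ᶠ L : ℝ in atTop, H * L ≤ Nat.primeCounting ⌊L ^ a⌋₊ ∧ 1 ≤ L ∧ 1 ≤ log L ∧
      log L ≤ η * L := by
    filter_upwards [eventually_mul_le_primeCounting_rpow H ha1, eventually_ge_atTop 1,
      tendsto_log_atTop.eventually_ge_atTop 1, isLittleO_log_id_atTop.bound hηpos]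
      with L h1 h2 h3 h4
    rw [norm_of_nonneg (by linarith), id, norm_of_nonneg (by linarith)] at h4
    exact ⟨h1, h2, h3, h4⟩
  filter_upwards [hlog.eventually hmain, eventually_ge_atTop 1] with k hk hk1
  obtain ⟨hpi, hL1, hlogL, hηL⟩ := hk
  set L := log (k : ℝ) with hL
  have hkpos : (0 : ℝ) < k := by exact_mod_cast hk1
  have hquot : 1 ≤ η * (L / log L) := by
    rw [mul_div_assoc', le_div_iff₀ (by linarith)]
    linarith
  have hquotpos : 0 < L / log L := by positivity
  -- The largest `t` with `(L ^ a) ^ t ≤ exp L = k`.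
  set t := ⌊L / (a * log L)⌋₊ with ht
  have hsplit : L / (a * log L) = 1 / a * (L / log L) := by
    field_simp
  have ht1 : 0 < t := by
    refine Nat.floor_pos.2 ?_
    rw [hsplit]
    exact hquot.trans (mul_le_mul_of_nonneg_right (min_le_left _ _) hquotpos.le)
  have htle : (t : ℝ) ≤ L / (a * log L) := Nat.floor_le (by positivity)
  have htL : (t : ℝ) ≤ L := htle.trans (div_le_self (by linarith) (by nlinarith))
  have hx : ⌊L ^ a⌋₊ ^ t ≤ k := by
    have h1 : ((⌊L ^ a⌋₊ : ℕ) : ℝ) ^ t ≤ k := calc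
      ((⌊L ^ a⌋₊ : ℕ) : ℝ) ^ t ≤ (L ^ a) ^ t :=
        pow_le_pow_left₀ (Nat.cast_nonneg _) (Nat.floor_le (by positivity)) t
      _ = exp (log L * a * t) := by
        rw [← rpow_natCast, ← rpow_mul (by linarith), rpow_def_of_pos (by linarith), mul_assoc]
      _ ≤ exp L := by
        refine exp_le_exp.2 ?_
        rw [le_div_iff₀ (by positivity)] at htle
        linarith
      _ = k := exp_log hkpos
    exact_mod_cast h1
  have hcount : H * t ≤ Nat.primeCounting ⌊L ^ a⌋₊ := by
    have : (H : ℝ) * t ≤ Nat.primeCounting ⌊L ^ a⌋₊ :=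
      (mul_le_mul_of_nonneg_left htL (Nat.cast_nonneg H)).trans hpi
    exact_mod_cast this
  have hfin : ((H * t : ℕ) : ℝ) ≤ maxEssential (H + 1) k := by
    exact_mod_cast mul_le_maxEssential hH ht1 hcount hx
  refine le_trans ?_ hfin
  have htge : L / (a * log L) - 1 ≤ t := (Nat.sub_one_lt_floor _).le
  have hgap : 1 ≤ c ^ 2 / a * (L / log L) :=
    hquot.trans (mul_le_mul_of_nonneg_right (min_le_right _ _) hquotpos.le)
  have hid : 1 / a - c ^ 2 / a = 1 - c := by
    field_simp
    rw [ha]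
    ring
  have : (1 - c) * (L / log L) ≤ t := by
    rw [← hid, sub_mul, ← hsplit]
    linarith
  push_cast
  calc (1 - c) * (H * (L / log L)) = H * ((1 - c) * (L / log L)) := by ring
    _ ≤ H * t := mul_le_mul_of_nonneg_left this (Nat.cast_nonneg H)

/-! ### Asymptotic upper bound. -/

theorem mul_log_sub_le_log_factorial {s : ℕ} (hs : 0 < s) :
    s * (log s - 1) ≤ log (s.factorial : ℝ) := by
  have hs' : (0 : ℝ) < s := by exact_mod_cast hs
  have hf : (0 : ℝ) < s.factorial := by exact_mod_cast s.factorial_pos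
  have h := log_le_log (by positivity) (pow_div_factorial_le_exp _ (Nat.cast_nonneg s) s)
  rw [log_exp, log_div (by positivity) hf.ne', log_pow] at h
  linarith

/-- The final inequality contradicts the logarithm of `s ! ≤ (s * k + 1) ^ H` for `L = log k` and `s
= ⌈M⌉₊`. -/
theorem eventually_lt_mul_log {H : ℕ} (hH : 0 < H) {c : ℝ} (hc : 0 < c) :
    ∀ᶠ L : ℝ in atTop, ∀ M : ℝ, M = (1 + c) * (H * (L / log L)) →
      1 ≤ log M ∧ 1 ≤ M ∧ H * (L + log (M + 2)) < M * (log M - 1) := by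
  have hH1 : (1 : ℝ) ≤ H := by exact_mod_cast hH
  -- Chosen so that `δ * (2 + c) < c`, that is, `1 + δ < (1 + c) * (1 - δ)`.
  set δ := c / (2 * (2 + c)) with hδ
  have hδpos : 0 < δ := by positivity
  have hδ1 : δ < 1 := by
    rw [hδ, div_lt_one (by positivity)]
    linarith
  set K := (1 + c) * H + 2 with hK
  have hKpos : 0 < K := by positivity
  filter_upwards [eventually_ge_atTop 1, tendsto_log_atTop.eventually_ge_atTop (2 / (1 - δ)),
    tendsto_log_atTop.eventually_ge_atTop 1,
    tendsto_log_atTop.eventually (isLittleO_log_id_atTop.bound (half_pos hδpos)),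
    tendsto_log_atTop.eventually_ge_atTop (2 / δ),
    isLittleO_log_id_atTop.bound (half_pos hδpos), eventually_ge_atTop (2 * log K / δ)]
    with L hL1 hlog2 hlog1 hll hlogδ hl hLK
  rintro M rfl
  set M := (1 + c) * (H * (L / log L)) with hM
  have hL0 : 0 < L := by linarith
  have hlogpos : 0 < log L := by linarith
  rw [norm_of_nonneg (log_nonneg hlog1), id, norm_of_nonneg hlogpos.le] at hll
  rw [norm_of_nonneg hlogpos.le, id, norm_of_nonneg hL0.le] at hl
  rw [div_le_iff₀ hδpos] at hlogδ hLK
  rw [div_le_iff₀ (by linarith)] at hlog2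
  have hquot : 0 < L / log L := by positivity
  have hLM : L / log L ≤ M := by
    have : 1 ≤ (1 + c) * H := by nlinarith
    rw [hM, ← mul_assoc]
    exact le_mul_of_one_le_left hquot.le this
  have hlogM : (1 - δ) * log L ≤ log M - 1 := by
    have := log_le_log hquot hLM
    rw [log_div hL0.ne' hlogpos.ne'] at this
    linarith
  have hlogM1 : 1 ≤ log M := by linarith
  have hMpos : 0 < M := hquot.trans_le hLM
  have hM1 : 1 ≤ M := by
    by_contra hlt
    have := log_nonpos hMpos.le (not_le.1 hlt).le
    linarith
  refine ⟨hlogM1, hM1, ?_⟩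
  have hMK : M + 2 ≤ K * L := by
    have h1 : L / log L ≤ L := div_le_self hL0.le hlog1
    have h2 : M ≤ (1 + c) * H * L := by
      rw [hM, ← mul_assoc]
      exact mul_le_mul_of_nonneg_left h1 (by positivity)
    rw [hK]
    linarith
  have hlogM2 : log (M + 2) ≤ δ * L := by
    have := log_le_log (by linarith) hMK
    rw [log_mul hKpos.ne' hL0.ne'] at this
    linarith
  have hMlog : M * ((1 - δ) * log L) = (1 + c) * (1 - δ) * (H * L) := by
    rw [hM]
    field_simp
  have hgap : 1 + δ < (1 + c) * (1 - δ) := by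
    have : δ * (2 + c) = c / 2 := by
      rw [hδ]
      field_simp
    linarith
  have hHL : 0 < (H : ℝ) * L := by positivity
  calc H * (L + log (M + 2)) ≤ H * (L + δ * L) :=
        mul_le_mul_of_nonneg_left (by linarith) (by linarith)
    _ = (1 + δ) * (H * L) := by ring
    _ < (1 + c) * (1 - δ) * (H * L) := mul_lt_mul_of_pos_right hgap hHL
    _ = M * ((1 - δ) * log L) := hMlog.symm
    _ ≤ M * (log M - 1) := mul_le_mul_of_nonneg_left hlogM hMpos.le

theorem eventually_maxEssential_le {H : ℕ} (hH : 0 < H) {c : ℝ} (hc : 0 < c) :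
    ∀ᶠ k : ℕ in atTop,
      (maxEssential (H + 1) k : ℝ) ≤ (1 + c) * (H * (log k / log (log k))) := by
  have hlog : Tendsto (fun k : ℕ => log (k : ℝ)) atTop atTop :=
    tendsto_log_atTop.comp tendsto_natCast_atTop_atTop
  filter_upwards [hlog.eventually (eventually_lt_mul_log hH hc), eventually_ge_atTop 1]
    with k hk hk1
  obtain ⟨hlogM, hM1, hlt⟩ := hk _ rfl
  set M := (1 + c) * (H * (log k / log (log k))) with hM
  by_contra! hcon
  have hkpos : (0 : ℝ) < k := by exact_mod_cast hk1
  set s := ⌈M⌉₊ with hs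
  have hMs : M ≤ s := Nat.le_ceil M
  have hsM : (s : ℝ) < M + 1 := Nat.ceil_lt_add_one (by linarith)
  have hspos : 0 < s := Nat.ceil_pos.2 (by linarith)
  have hfact := factorial_le_of_le_maxEssential (Nat.succ_pos H) (Nat.ceil_le.2 hcon.le)
  rw [Nat.succ_eq_add_one, Nat.add_sub_cancel] at hfact
  have hfact' : ((s.factorial : ℕ) : ℝ) ≤ (s * k + 1) ^ H := by exact_mod_cast hfact
  have hupper : log (s.factorial : ℝ) ≤ H * (log k + log (M + 2)) := by
    have h1 : log (s * k + 1 : ℝ) ≤ log (k * (M + 2)) := by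
      refine log_le_log (by positivity) ?_
      have hk1' : (1 : ℝ) ≤ k := by exact_mod_cast hk1
      nlinarith
    rw [log_mul hkpos.ne' (by linarith)] at h1
    calc log (s.factorial : ℝ) ≤ log ((s * k + 1 : ℝ) ^ H) :=
          log_le_log (by exact_mod_cast s.factorial_pos) hfact'
      _ = H * log (s * k + 1 : ℝ) := log_pow _ _
      _ ≤ _ := mul_le_mul_of_nonneg_left h1 (Nat.cast_nonneg H)
  have hlower : M * (log M - 1) ≤ s * (log s - 1) :=
    mul_le_mul hMs (sub_le_sub_right (log_le_log (by linarith) hMs) 1) (by linarith)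
      (Nat.cast_nonneg s)
  linarith [mul_log_sub_le_log_factorial hspos]

/-! ### Order one and the final statement. -/

/-- For `h = 1` the bound of `modulus_le` has exponent `0`, so no prime fits. -/
theorem maxEssential_one (k : ℕ) : maxEssential 1 k = 0 := by
  obtain ⟨A, hA, hcount⟩ := (isGreatest_maxEssential one_pos k).1
  by_contra hne
  have hpos : (1 : ℕ∞) ≤ numEssential A k := by
    rw [hcount]
    exact_mod_cast Nat.one_le_iff_ne_zero.2 hne
  obtain ⟨E, hE, hEk⟩ := Set.one_le_encard_iff_nonempty.1 hpos
  obtain ⟨p, hp, hcong⟩ := ((IsIntegerBasis.not_diff_iff ⟨1, hA⟩ E).1 hE.prop.2)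
  obtain ⟨y, hy⟩ := ((IsIntegerBasis.infinite ⟨1, hA⟩).sdiff E.finite_toSet).nonempty
  have := hA.modulus_le hp.pos E fun x hx => hcong x hx y hy
  exact hp.one_lt.not_ge (by simpa using this)

end EssentialSubsets

theorem theorem1p1 (h : ℕ) (hh : 0 < h) :
    (∀ k : ℕ, 0 < k →
      IsGreatest (EssentialSubsets.essentialCounts h k)
        (EssentialSubsets.maxEssential h k : ℕ∞)) ∧
    Asymptotics.IsEquivalent Filter.atTop
      (fun k : ℕ => (EssentialSubsets.maxEssential h k : ℝ))
      (fun k : ℕ => ((h : ℝ) - 1) * (Real.log (k : ℝ) / Real.log (Real.log (k : ℝ)))) := by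
  refine ⟨fun k _ => EssentialSubsets.isGreatest_maxEssential hh k, ?_⟩
  obtain ⟨H, rfl⟩ : ∃ H, h = H + 1 := ⟨h - 1, by omega⟩
  simp only [Nat.cast_add, Nat.cast_one, add_sub_cancel_right]
  rcases Nat.eq_zero_or_pos H with rfl | hH
  · simp only [zero_add, EssentialSubsets.maxEssential_one, Nat.cast_zero, zero_mul]
    exact Asymptotics.IsEquivalent.refl
  refine Asymptotics.isLittleO_iff.2 fun c hc => ?_
  have hlog : Filter.Tendsto (fun k : ℕ => Real.log (k : ℝ)) Filter.atTop Filter.atTop :=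
    Real.tendsto_log_atTop.comp tendsto_natCast_atTop_atTop
  filter_upwards [EssentialSubsets.eventually_le_maxEssential hH hc,
    EssentialSubsets.eventually_maxEssential_le hH hc, hlog.eventually_ge_atTop 1]
    with k hlow hup hk
  have hg : 0 ≤ (H : ℝ) * (Real.log k / Real.log (Real.log k)) :=
    mul_nonneg (Nat.cast_nonneg H) (div_nonneg (by linarith) (Real.log_nonneg hk))
  rw [Pi.sub_apply, Real.norm_of_nonneg hg, Real.norm_eq_abs, abs_le]
  constructor <;> linarith
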